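/- Let $A$ be a fixed real $m\times n$ matrix, and let $X$ be a random real $m\times n$ matrix whose entries $X_{jk}$ are (jointly) independent random variables with $\mathbb{E}X=A$, that is, $\mathbb{E}X_{jk}=A_{jk}$ for all $j,k$. Let $D>0$ and assume that $|X_{jk}|\le D/2$ almost surely for all $j,k$. Let $\|\cdot\|$ denote the spectral norm (the largest singular value, i.e. the operator norm from $\ell_2^n$ to $\ell_2^m$). Then $\|A-X\|$ is integrable, and for all $t>0$, $$\mathbb{P}\bigl(\|A-X\|>\mathbb{E}\|A-X\|+t\bigr)\le e^{-t^2/(4D^2)}.$$ -/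

import Mathlib

-- The norm on matrices is the operator norm from `ℓ₂ⁿ` to `ℓ₂ᵐ`, i.e. the largest singular value.
open scoped Matrix.Norms.L2Operator

open MeasureTheory Set

/-! This is Maurey's transport-type argument. A probability measure on an interval of length `D` has
the convex property (τ) with cost `x ^ 2 / (4 * D ^ 2)` (`convexPropertyTau_real`), and the property
passes to products with summed costs (`ConvexPropertyTau.prod`). For `Z = f(Y)` with `f` convex and
1-Lipschitz in the Euclidean distance, applying it to `s * f` gives `E e^{sZ} * E e^{-sZ} ≤
e^{s²D²}`. Jensen bounds the second factor below by `e^{-s E Z}`, and Chernoff's bound concludes.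
The norm `‖A - X‖` is such a function of the entries, as the operator norm is at most the
Hilbert–Schmidt norm. -/

/-- The exponential as an extended nonnegative real. -/
noncomputable def eexp (x : ℝ) : ENNReal := ENNReal.ofReal (Real.exp x)

lemma eexp_add (x y : ℝ) : eexp (x + y) = eexp x * eexp y := by
  rw [eexp, Real.exp_add, ENNReal.ofReal_mul (Real.exp_pos x).le, eexp, eexp]

@[simp] lemma eexp_zero : eexp 0 = 1 := by simp [eexp]

lemma eexp_ne_zero (x : ℝ) : eexp x ≠ 0 := by simp [eexp, Real.exp_pos]

lemma eexp_ne_top (x : ℝ) : eexp x ≠ ⊤ := ENNReal.ofReal_ne_top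

lemma eexp_le_eexp {x y : ℝ} : eexp x ≤ eexp y ↔ x ≤ y := by
  rw [eexp, eexp, ENNReal.ofReal_le_ofReal_iff (Real.exp_pos y).le, Real.exp_le_exp]

lemma eexp_rpow (x a : ℝ) : eexp x ^ a = eexp (a * x) := by
  rw [eexp, ENNReal.ofReal_rpow_of_pos (Real.exp_pos x), ← Real.exp_mul, mul_comm, eexp]

lemma measurable_eexp : Measurable eexp :=
  ENNReal.measurable_ofReal.comp Real.measurable_exp

lemma Measurable.eexp {α : Type*} [MeasurableSpace α] {g : α → ℝ} (hg : Measurable g) :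
    Measurable fun a => eexp (g a) :=
  measurable_eexp.comp hg

lemma exists_eexp_eq {r : ENNReal} (h0 : r ≠ 0) (ht : r ≠ ⊤) : ∃ x, eexp x = r :=
  ⟨Real.log r.toReal, by
    rw [eexp, Real.exp_log (ENNReal.toReal_pos h0 ht), ENNReal.ofReal_toReal ht]⟩

/-- A log-integral of exponentials of convex functions is convex. -/
lemma convexOn_of_eexp_eq_lintegral {α E : Type*} [MeasurableSpace α] {μ : Measure α}
    [AddCommGroup E] [Module ℝ E] {q : α → E → ℝ} {F : E → ℝ}
    (hq : ∀ a, ConvexOn ℝ univ (q a)) (hm : ∀ x, Measurable fun a => q a x)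
    (hF : ∀ x, eexp (F x) = ∫⁻ a, eexp (q a x) ∂μ) : ConvexOn ℝ univ F := by
  refine ⟨convex_univ, fun x _ y _ a b ha hb hab => ?_⟩
  rw [← eexp_le_eexp, eexp_add, smul_eq_mul, smul_eq_mul, ← eexp_rpow, ← eexp_rpow, hF, hF, hF]
  -- Convexity of each `q t` under the integral, then Hölder with weights `a` and `b`.
  refine le_trans (lintegral_mono fun t => ?_) (ENNReal.lintegral_mul_norm_pow_le
    (hm x).eexp.aemeasurable (hm y).eexp.aemeasurable
    ha hb hab)
  simp only [eexp_rpow, ← eexp_add, eexp_le_eexp]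
  simpa using (hq t).2 (mem_univ x) (mem_univ y) ha hb hab

/-- Partial minimization preserves convexity. -/
lemma ConvexOn.iInf_right {E F : Type*} [AddCommGroup E] [Module ℝ E] [AddCommGroup F]
    [Module ℝ F] {φ : E × F → ℝ} (hφ : ConvexOn ℝ univ φ) (hb : BddBelow (range φ)) :
    ConvexOn ℝ univ fun x => ⨅ z, φ (x, z) := by
  have hb' : ∀ x, BddBelow (range fun z => φ (x, z)) := fun x =>
    hb.mono (by rintro _ ⟨z, rfl⟩; exact ⟨_, rfl⟩)
  refine ⟨convex_univ, fun x _ y _ a b ha hb hab => ?_⟩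
  simp only [smul_eq_mul, Real.mul_iInf_of_nonneg ha, Real.mul_iInf_of_nonneg hb]
  refine le_ciInf_add_ciInf fun z z' => ?_
  refine (ciInf_le (hb' _) (a • z + b • z')).trans ?_
  simpa using hφ.2 (mem_univ (x, z)) (mem_univ (y, z')) ha hb hab

/-! ### Convex property (τ) and tensorization -/

/-- Maurey's property (τ) for convex functions, with cost `w`: the infimal convolution of a convex
function `f` with `w` enters through an arbitrary measurable `G` bounded by its exponential. -/
def ConvexPropertyTau {E : Type*} [MeasurableSpace E] [AddCommGroup E] [Module ℝ E]
    (μ : Measure E) (w : E → ℝ) : Prop :=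
  ∀ f : E → ℝ, ConvexOn ℝ univ f → BddBelow (range f) → ∀ G : E → ENNReal, Measurable G →
    (∀ x y, G x ≤ eexp (f y + w (x - y))) → (∫⁻ x, G x ∂μ) * ∫⁻ x, eexp (-f x) ∂μ ≤ 1

lemma ConvexOn.measurable {E : Type*} [NormedAddCommGroup E] [NormedSpace ℝ E]
    [FiniteDimensional ℝ E] [MeasurableSpace E] [BorelSpace E] {f : E → ℝ}
    (hf : ConvexOn ℝ univ f) : Measurable f :=
  hf.locallyLipschitz.continuous.measurable

/-- Convolve in the first variable only to get `q`, and set `Φ y = log ∫ exp (q (x, y)) ∂μ`. By (τ)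
for `μ`, the integral of `exp (-f)` over the first variable is at most `exp (-Φ)`. Since `Φ` is
again convex, (τ) for `ν` applies to it. -/
lemma ConvexPropertyTau.prod {E F : Type*}
    [NormedAddCommGroup E] [NormedSpace ℝ E] [FiniteDimensional ℝ E] [MeasurableSpace E]
    [BorelSpace E] [NormedAddCommGroup F] [NormedSpace ℝ F] [FiniteDimensional ℝ F]
    [MeasurableSpace F] [BorelSpace F] {μ : Measure E} {ν : Measure F} [IsProbabilityMeasure μ]
    [SFinite ν] {u : E → ℝ} {v : F → ℝ} (hμ : ConvexPropertyTau μ u) (hν : ConvexPropertyTau ν v)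
    (hu : ConvexOn ℝ univ u) (hu0 : ∀ x, 0 ≤ u x) :
    ConvexPropertyTau (μ.prod ν) fun p => u p.1 + v p.2 := by
  intro f hf ⟨B, hB⟩ G hG hGf
  replace hB : ∀ p, B ≤ f p := fun p => hB ⟨p, rfl⟩
  let φ : (E × F) × E → ℝ := fun p => f (p.2, p.1.2) + u (p.1.1 - p.2)
  have hφ : ConvexOn ℝ univ φ :=
    (hf.comp_linearMap ((LinearMap.snd ℝ (E × F) E).prod
        ((LinearMap.snd ℝ E F).comp (LinearMap.fst ℝ (E × F) E)))).add
      (hu.comp_linearMap ((LinearMap.fst ℝ E F).comp (LinearMap.fst ℝ (E × F) E) -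
        LinearMap.snd ℝ (E × F) E))
  have hφB : ∀ p, B ≤ φ p := fun p => by have := hB (p.2, p.1.2); have := hu0 (p.1.1 - p.2); grind
  have hφb : BddBelow (range φ) := ⟨B, by rintro _ ⟨p, rfl⟩; exact hφB p⟩
  let q : E × F → ℝ := fun p => ⨅ z, φ (p, z)
  have hq : ConvexOn ℝ univ q := hφ.iInf_right hφb
  have hqm : Measurable q := hq.measurable
  have hqB : ∀ p, B ≤ q p := fun p => le_ciInf fun z => hφB _
  have hqle : ∀ p z, q p ≤ φ (p, z) := fun p z => ciInf_le ⟨B, by rintro _ ⟨z, rfl⟩; exact hφB _⟩ z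
  have hfy : ∀ y, ConvexOn ℝ univ fun x => f (x, y) := fun y => by
    refine ⟨convex_univ, fun x _ x' _ a b ha hb hab => ?_⟩
    have := hf.2 (mem_univ (x, y)) (mem_univ (x', y)) ha hb hab
    simpa [← add_smul, hab] using this
  have hqx : ∀ x, ConvexOn ℝ univ fun y => q (x, y) := fun x => by
    refine ⟨convex_univ, fun y _ y' _ a b ha hb hab => ?_⟩
    have := hq.2 (mem_univ (x, y)) (mem_univ (x, y')) ha hb hab
    simpa [← add_smul, hab] using this
  have hqmy : ∀ y, Measurable fun x => q (x, y) := fun y => hqm.comp measurable_prodMk_right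
  have key : ∀ y, (∫⁻ x, eexp (q (x, y)) ∂μ) * ∫⁻ x, eexp (-f (x, y)) ∂μ ≤ 1 := fun y =>
    hμ _ (hfy y) ⟨B, by rintro _ ⟨x, rfl⟩; exact hB _⟩ _ (hqmy y).eexp
      fun x x' => eexp_le_eexp.2 (hqle (x, y) x')
  have hpos : ∀ g : E → ℝ, Measurable g → ∫⁻ x, eexp (g x) ∂μ ≠ 0 := fun g hg h => by
    rw [lintegral_eq_zero_iff hg.eexp] at h
    obtain ⟨x, hx⟩ := h.exists
    exact eexp_ne_zero _ hx
  have hfpos : ∀ y, ∫⁻ x, eexp (-f (x, y)) ∂μ ≠ 0 := fun y => hpos _ (hfy y).measurable.neg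
  have hqfin : ∀ y, ∫⁻ x, eexp (q (x, y)) ∂μ ≠ ⊤ := fun y h => by
    have := key y
    rw [h, ENNReal.top_mul (hfpos y)] at this
    simp at this
  choose Φ hΦ using fun y => exists_eexp_eq (hpos _ (hqmy y)) (hqfin y)
  have hΦc : ConvexOn ℝ univ Φ := convexOn_of_eexp_eq_lintegral (q := fun x y => q (x, y)) hqx hqmy hΦ
  have hΦB : ∀ y, B ≤ Φ y := fun y => by
    rw [← eexp_le_eexp, hΦ]
    calc eexp B = ∫⁻ _, eexp B ∂μ := by simp
      _ ≤ _ := lintegral_mono fun x => eexp_le_eexp.2 (hqB _)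
  have hneg : ∀ y, ∫⁻ x, eexp (-f (x, y)) ∂μ ≤ eexp (-Φ y) := fun y => by
    have h := mul_le_mul_right (key y) (eexp (-Φ y))
    rwa [← hΦ, ← mul_assoc, ← eexp_add, neg_add_cancel, eexp_zero, one_mul, mul_one] at h
  have hstep := hν Φ hΦc ⟨B, by rintro _ ⟨y, rfl⟩; exact hΦB y⟩ (fun y => ∫⁻ x, G (x, y) ∂μ)
    hG.lintegral_prod_left' fun y y' => ?_
  · rw [lintegral_prod_symm _ hG.aemeasurable,
      lintegral_prod_symm (fun p => eexp (-f p)) hf.measurable.neg.eexp.aemeasurable]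
    exact (mul_le_mul_right (lintegral_mono hneg) _).trans hstep
  · rw [eexp_add, hΦ, ← lintegral_mul_const _ (hqmy y').eexp]
    refine lintegral_mono fun x => ?_
    -- Passing to the logarithm of `G (x, y)` lets the bounds for all `z` become a bound by the
    -- infimum `q (x, y')`.
    obtain h0 | h0 := eq_or_ne (G (x, y)) 0
    · simp [h0]
    have ht : G (x, y) ≠ ⊤ := ne_top_of_le_ne_top (eexp_ne_top _) (hGf (x, y) (x, y))
    obtain ⟨g, hg⟩ := exists_eexp_eq h0 ht
    simp only [← hg, ← eexp_add, eexp_le_eexp]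
    rw [← sub_le_iff_le_add]
    refine le_ciInf fun z => ?_
    have := hGf (x, y) (z, y')
    rw [← hg, eexp_le_eexp] at this
    simp only [φ, Prod.mk_sub_mk] at this ⊢
    linarith

/-! ### Property (τ) on an interval -/

/-- Factoring out `exp (-d²/2)` leaves a `cosh`, and `cosh u ≤ exp (u²/2)` reduces the claim to
`-d³/2 + d⁴/8 ≤ 0`. -/
lemma Real.exp_sub_sq_add_exp_neg_le_two {d : ℝ} (h0 : 0 ≤ d) (h1 : d ≤ 1) :
    Real.exp (d - d ^ 2) + Real.exp (-d) ≤ 2 := by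
  have h : Real.exp (d - d ^ 2) + Real.exp (-d)
      = 2 * (Real.exp (-(d ^ 2 / 2)) * Real.cosh (d - d ^ 2 / 2)) := by
    rw [Real.cosh_eq, mul_div_assoc', mul_div_cancel₀ _ two_ne_zero, mul_add, ← Real.exp_add,
      ← Real.exp_add]
    ring_nf
  have h2 : Real.exp (-(d ^ 2 / 2)) * Real.cosh (d - d ^ 2 / 2) ≤ 1 := by
    calc _ ≤ Real.exp (-(d ^ 2 / 2)) * Real.exp ((d - d ^ 2 / 2) ^ 2 / 2) := by
          gcongr; exact Real.cosh_le_exp_half_sq _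
      _ ≤ 1 := by
          rw [← Real.exp_add, Real.exp_le_one_iff]
          nlinarith [mul_nonneg h0 (sq_nonneg d), mul_nonneg (mul_nonneg h0 (sq_nonneg d)) (sub_nonneg.2 h1)]
  linarith

/-- The two-point inequality behind property (τ) on an interval of length `D`. -/
lemma ConvexOn.exists_exp_add_exp_le_two {f : ℝ → ℝ} (hf : ConvexOn ℝ univ f) {D : ℝ} (hD : 0 < D)
    {x y : ℝ} (hxy : |x - y| ≤ D) (hle : f y ≤ f x) :
    ∃ z, Real.exp (f z + (x - z) ^ 2 / (4 * D ^ 2) - f y) + Real.exp (f y - f x) ≤ 2 := by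
  have hsq : (x - y) ^ 2 ≤ D ^ 2 := sq_le_sq.2 (by rwa [abs_of_pos hD])
  have hconv : ∀ θ : ℝ, 0 ≤ θ → θ ≤ 1 →
      f ((1 - θ) * x + θ * y) + (x - ((1 - θ) * x + θ * y)) ^ 2 / (4 * D ^ 2) - f y
        ≤ (f x - f y) - θ * (f x - f y) + θ ^ 2 / 4 := fun θ h0 h1 => by
    have h := hf.2 (mem_univ x) (mem_univ y) (sub_nonneg.2 h1) h0 (by ring)
    simp only [smul_eq_mul] at h
    have h2 : (x - ((1 - θ) * x + θ * y)) ^ 2 / (4 * D ^ 2) ≤ θ ^ 2 / 4 := by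
      rw [div_le_div_iff₀ (by positivity) (by norm_num)]
      nlinarith [mul_le_mul_of_nonneg_left hsq (sq_nonneg θ)]
    linarith
  set d := f x - f y with hd
  have hd0 : 0 ≤ d := sub_nonneg.2 hle
  have hneg : f y - f x = -d := by ring
  rw [hneg]
  -- The bound `d - θ * d + θ²/4` is least at `θ = 2 * d`, with value `d - d²`. Once `d ≥ 1/2`, take
  -- `θ = 1`: the value `1/4` is that of `d = 1/2`.
  rcases le_total d (1 / 2) with h | h
  · refine ⟨_, (add_le_add_left (Real.exp_le_exp.2 (hconv (2 * d) (by linarith) (by linarith))) _).trans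
      (le_trans (le_of_eq ?_) (Real.exp_sub_sq_add_exp_neg_le_two hd0 (by linarith)))⟩
    ring_nf
  · refine ⟨_, (add_le_add (Real.exp_le_exp.2 (hconv 1 zero_le_one le_rfl))
      (Real.exp_le_exp.2 (neg_le_neg h))).trans
      (le_trans (le_of_eq ?_) (Real.exp_sub_sq_add_exp_neg_le_two (d := 1 / 2) (by norm_num)
        (by norm_num)))⟩
    ring_nf

/-- Symmetrizing over two independent copies turns twice the product into a double integral whose
integrand is pointwise at most 2. The point with the smaller value of `f` is its own competitor in
the convolution. -/
lemma convexPropertyTau_real {μ : Measure ℝ} [IsProbabilityMeasure μ] {D : ℝ} (hD : 0 < D)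
    (hμ : ∀ᵐ x ∂μ, |x| ≤ D / 2) : ConvexPropertyTau μ fun x => x ^ 2 / (4 * D ^ 2) := by
  intro f hf _ G hG hGf
  have hE : Measurable fun x => eexp (-f x) := hf.measurable.neg.eexp
  have aux : ∀ x y, |x - y| ≤ D → f y ≤ f x → G x * eexp (-f y) + G y * eexp (-f x) ≤ 2 := by
    intro x y hxy hle
    obtain ⟨z, hz⟩ := hf.exists_exp_add_exp_le_two hD hxy hle
    calc _ ≤ eexp (f z + (x - z) ^ 2 / (4 * D ^ 2)) * eexp (-f y)
          + eexp (f y + (y - y) ^ 2 / (4 * D ^ 2)) * eexp (-f x) :=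
          add_le_add (mul_le_mul_left (hGf x z) _) (mul_le_mul_left (hGf y y) _)
      _ = ENNReal.ofReal (Real.exp (f z + (x - z) ^ 2 / (4 * D ^ 2) - f y)
          + Real.exp (f y - f x)) := by
          rw [← eexp_add, ← eexp_add, ENNReal.ofReal_add (Real.exp_pos _).le (Real.exp_pos _).le,
            eexp, eexp]
          simp [sub_eq_add_neg]
      _ ≤ 2 := by simpa using ENNReal.ofReal_le_ofReal hz
  have h2 : ∫⁻ x, ∫⁻ y, (G x * eexp (-f y) + G y * eexp (-f x)) ∂μ ∂μ ≤ 2 := by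
    calc _ ≤ ∫⁻ _, ∫⁻ _, 2 ∂μ ∂μ := by
          refine lintegral_mono_ae ?_
          filter_upwards [hμ] with x hx
          refine lintegral_mono_ae ?_
          filter_upwards [hμ] with y hy
          have hxy : |x - y| ≤ D := (abs_sub x y).trans (by linarith)
          rcases le_total (f y) (f x) with h | h
          · exact aux x y hxy h
          · rw [add_comm]; exact aux y x (by rwa [abs_sub_comm]) h
      _ = 2 := by simp
  have h3 : ∫⁻ x, ∫⁻ y, (G x * eexp (-f y) + G y * eexp (-f x)) ∂μ ∂μ
      = 2 * ((∫⁻ x, G x ∂μ) * ∫⁻ x, eexp (-f x) ∂μ) := by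
    simp_rw [lintegral_add_left (hE.const_mul _), lintegral_const_mul _ hE, lintegral_mul_const _ hG]
    rw [lintegral_add_left (hG.mul_const _), lintegral_mul_const _ hG, lintegral_const_mul _ hE,
      two_mul]
  rw [h3] at h2
  exact (ENNReal.mul_le_mul_iff_right two_ne_zero ENNReal.ofNat_ne_top).1 (by simpa using h2)

lemma ConvexPropertyTau.pi {N : ℕ} {μ : Fin N → Measure ℝ} [∀ i, IsProbabilityMeasure (μ i)]
    {u : ℝ → ℝ} (h : ∀ i, ConvexPropertyTau (μ i) u) (hu : ConvexOn ℝ univ u)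
    (hu0 : ∀ x, 0 ≤ u x) : ConvexPropertyTau (Measure.pi μ) fun x => ∑ i, u (x i) := by
  induction N with
  | zero =>
    intro f _ _ G _ hGf
    rw [Measure.pi_of_empty μ 0, lintegral_dirac, lintegral_dirac]
    calc _ ≤ eexp (f 0) * eexp (-f 0) := mul_le_mul_left (by simpa using hGf 0 0) _
      _ = 1 := by rw [← eexp_add]; simp
  | succ N ih =>
    intro f hf ⟨B, hB⟩ G hG hGf
    have e := (measurePreserving_piFinSuccAbove μ 0).symm
    rw [← e.lintegral_comp_emb (MeasurableEquiv.measurableEmbedding _),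
      ← e.lintegral_comp_emb (MeasurableEquiv.measurableEmbedding _)]
    have hcons : ∀ p, (MeasurableEquiv.piFinSuccAbove (fun _ => ℝ) 0).symm p
        = Fin.consLinearEquiv ℝ (fun _ : Fin (N + 1) => ℝ) p := fun p => by
      simp [MeasurableEquiv.piFinSuccAbove, Fin.insertNthEquiv]
      rfl
    have hm : Measurable (Fin.consLinearEquiv ℝ (fun _ : Fin (N + 1) => ℝ)) := by
      rw [← funext hcons]; exact MeasurableEquiv.measurable _
    simp only [hcons]
    refine (h 0).prod (ih fun i => h (Fin.succAbove 0 i)) hu hu0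
      (fun p => f (Fin.consLinearEquiv ℝ (fun _ => ℝ) p))
      (hf.comp_linearMap (Fin.consLinearEquiv ℝ (fun _ => ℝ)).toLinearMap)
      ⟨B, ?_⟩ _ (hG.comp hm) ?_
    · rintro _ ⟨p, rfl⟩; exact hB ⟨_, rfl⟩
    · intro x y
      refine (hGf _ (Fin.cons y.1 y.2)).trans (le_of_eq ?_)
      simp [Fin.sum_univ_succ]
      rfl

/-! ### Concentration for convex Lipschitz functions and matrix norms -/

lemma ConvexPropertyTau.lintegral_eexp_mul_le {N : ℕ} {ν : Measure (Fin N → ℝ)} {D : ℝ}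
    (hD : 0 < D) (h : ConvexPropertyTau ν fun x => ∑ i, x i ^ 2 / (4 * D ^ 2))
    {f : (Fin N → ℝ) → ℝ} (hf : ConvexOn ℝ univ f) (hb : ∀ x, 0 ≤ f x)
    (hL : ∀ x y, f x - f y ≤ √(∑ i, (x i - y i) ^ 2)) {s : ℝ} (hs : 0 ≤ s) :
    (∫⁻ x, eexp (s * f x) ∂ν) * ∫⁻ x, eexp (-s * f x) ∂ν ≤ eexp (s ^ 2 * D ^ 2) := by
  have hsf : ConvexOn ℝ univ fun x => s * f x := hf.smul hs
  have key := h _ hsf ⟨0, by rintro _ ⟨x, rfl⟩; exact mul_nonneg hs (hb x)⟩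
    (fun x => eexp (s * f x) * eexp (-(s ^ 2 * D ^ 2))) (hsf.measurable.eexp.mul_const _)
    fun x y => ?_
  · rw [lintegral_mul_const _ hsf.measurable.eexp] at key
    have := mul_le_mul_right key (eexp (s ^ 2 * D ^ 2))
    rw [mul_one] at this
    refine le_trans (le_of_eq ?_) this
    have h1 : eexp (s ^ 2 * D ^ 2) * eexp (-(s ^ 2 * D ^ 2)) = 1 := by rw [← eexp_add]; simp
    simp only [neg_mul]
    rw [mul_comm _ (eexp (-(s ^ 2 * D ^ 2))), ← mul_assoc, ← mul_assoc, h1, one_mul]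
  · rw [← eexp_add, eexp_le_eexp]
    have h1 := mul_le_mul_of_nonneg_left (hL x y) hs
    set r := √(∑ i, (x i - y i) ^ 2) with hr
    have h2 : ∑ i, (x - y) i ^ 2 / (4 * D ^ 2) = r ^ 2 / (4 * D ^ 2) := by
      rw [hr, Real.sq_sqrt (Finset.sum_nonneg fun _ _ => sq_nonneg _), Finset.sum_div]
      rfl
    -- This makes `s * f - s²D²` a lower bound for the convolution of `s * f` with the cost.
    have h3 : s * r ≤ s ^ 2 * D ^ 2 + r ^ 2 / (4 * D ^ 2) := by
      have h4 : s ^ 2 * D ^ 2 + r ^ 2 / (4 * D ^ 2) - s * r = (s * D - r / (2 * D)) ^ 2 := by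
        field_simp
        ring
      nlinarith [sq_nonneg (s * D - r / (2 * D))]
    change _ ≤ s * f y + ∑ i, (x - y) i ^ 2 / (4 * D ^ 2)
    rw [h2]
    linarith

lemma Matrix.l2_opNorm_le_sqrt_sum_sq {m n : ℕ} (M : Matrix (Fin m) (Fin n) ℝ) :
    ‖M‖ ≤ √(∑ p : Fin m × Fin n, M p.1 p.2 ^ 2) := by
  rw [Matrix.l2_opNorm_def]
  refine ContinuousLinearMap.opNorm_le_bound _ (Real.sqrt_nonneg _) fun x => ?_
  rw [EuclideanSpace.norm_eq, EuclideanSpace.norm_eq, ← Real.sqrt_mul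
    (Finset.sum_nonneg fun _ _ => sq_nonneg _), Fintype.sum_prod_type, Finset.sum_mul]
  refine Real.sqrt_le_sqrt (Finset.sum_le_sum fun i _ => ?_)
  simp only [Real.norm_eq_abs, sq_abs]
  exact Finset.sum_mul_sq_le_sq_mul_sq Finset.univ (M i) x

open ProbabilityTheory in
/-- Upper tail of a convex function, 1-Lipschitz for the Euclidean distance, of independent
bounded random variables. -/
lemma concentration_convex_lipschitz {Ω : Type*} [MeasurableSpace Ω] {μ : Measure Ω}
    [IsProbabilityMeasure μ] {N : ℕ} {Y : Fin N → Ω → ℝ} (hY : ∀ i, Measurable (Y i))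
    (hind : iIndepFun Y μ) {D : ℝ} (hD : 0 < D) (hbd : ∀ i, ∀ᵐ ω ∂μ, |Y i ω| ≤ D / 2)
    {f : (Fin N → ℝ) → ℝ} (hf : ConvexOn ℝ univ f) (hb : ∀ x, 0 ≤ f x)
    (hL : ∀ x y, f x - f y ≤ √(∑ i, (x i - y i) ^ 2)) :
    Integrable (fun ω => f fun i => Y i ω) μ ∧ ∀ t : ℝ, 0 < t →
      μ.real {ω | (∫ ω', f (fun i => Y i ω') ∂μ) + t < f fun i => Y i ω}
        ≤ Real.exp (-t ^ 2 / (4 * D ^ 2)) := by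
  have hmap := hind.map_fun_eq_pi_map fun i => (hY i).aemeasurable
  have hYm : Measurable fun ω i => Y i ω := measurable_pi_lambda _ hY
  have hprob : ∀ i, IsProbabilityMeasure (μ.map (Y i)) := fun i =>
    Measure.isProbabilityMeasure_map (hY i).aemeasurable
  have hτ : ConvexPropertyTau (μ.map fun ω i => Y i ω)
      fun x => ∑ i, x i ^ 2 / (4 * D ^ 2) := by
    rw [hmap]
    refine ConvexPropertyTau.pi (u := fun x => x ^ 2 / (4 * D ^ 2))
      (fun i => convexPropertyTau_real hD ?_) ?_ fun x => by positivity
    · exact (ae_map_iff (hY i).aemeasurable (measurableSet_le measurable_id.abs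
        measurable_const)).2 (hbd i)
    · simp_rw [div_eq_inv_mul]
      exact (even_two.convexOn_pow).smul (by positivity)
  set Z : Ω → ℝ := fun ω => f fun i => Y i ω with hZ
  have hZm : Measurable Z := hf.measurable.comp hYm
  have hZb : ∀ᵐ ω ∂μ, Z ω ∈ Icc 0 (f 0 + √(∑ _ : Fin N, (D / 2) ^ 2)) := by
    filter_upwards [ae_all_iff.2 hbd] with ω hω
    refine ⟨hb _, ?_⟩
    have h1 := hL (fun i => Y i ω) 0
    have h2 : √(∑ i, (Y i ω - (0 : Fin N → ℝ) i) ^ 2) ≤ √(∑ _ : Fin N, (D / 2) ^ 2) :=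
      Real.sqrt_le_sqrt (Finset.sum_le_sum fun i _ => by
        simpa using sq_le_sq.2 ((hω i).trans (le_abs_self _)))
    linarith
  have hZi : Integrable Z μ := Integrable.of_mem_Icc _ _ hZm.aemeasurable hZb
  have hexp : ∀ s, Integrable (fun ω => Real.exp (s * Z ω)) μ := fun s =>
    integrable_exp_mul_of_mem_Icc hZm.aemeasurable hZb
  refine ⟨hZi, fun t ht => ?_⟩
  -- The minimizer of `s²D² - s * t`.
  set s := t / (2 * D ^ 2) with hs
  have hs0 : 0 ≤ s := by positivity
  have hmgf : mgf Z μ s * mgf Z μ (-s) ≤ Real.exp (s ^ 2 * D ^ 2) := by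
    have h := hτ.lintegral_eexp_mul_le hD hf hb hL hs0
    rw [lintegral_map (hf.measurable.const_mul _).eexp hYm,
      lintegral_map (hf.measurable.const_mul _).eexp hYm] at h
    have hl : ∀ s, ∫⁻ ω, eexp (s * Z ω) ∂μ = ENNReal.ofReal (mgf Z μ s) := fun s =>
      (ofReal_integral_eq_lintegral_ofReal (hexp s)
        (ae_of_all _ fun _ => (Real.exp_pos _).le)).symm
    rw [hl, hl, ← ENNReal.ofReal_mul mgf_nonneg, eexp] at h
    exact (ENNReal.ofReal_le_ofReal_iff (Real.exp_pos _).le).1 h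
  have hjensen : Real.exp (-s * ∫ ω, Z ω ∂μ) ≤ mgf Z μ (-s) := by
    rw [← integral_const_mul]
    exact convexOn_exp.map_integral_le Real.continuous_exp.continuousOn isClosed_univ
      (ae_of_all _ fun _ => mem_univ _) (hZi.const_mul _) (hexp _)
  calc μ.real {ω | (∫ ω', Z ω' ∂μ) + t < Z ω} ≤ μ.real {ω | (∫ ω', Z ω' ∂μ) + t ≤ Z ω} :=
        measureReal_mono fun ω hω => by
          rw [mem_ofPred_eq] at hω ⊢
          exact hω.le
    _ ≤ Real.exp (-s * ((∫ ω', Z ω' ∂μ) + t)) * mgf Z μ s :=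
        measure_ge_le_exp_mul_mgf _ hs0 (hexp s)
    _ = Real.exp (-s * t) * (mgf Z μ s * Real.exp (-s * ∫ ω, Z ω ∂μ)) := by
        rw [mul_add, Real.exp_add]; ring
    _ ≤ Real.exp (-s * t) * Real.exp (s ^ 2 * D ^ 2) := by
        gcongr
        exact (mul_le_mul_of_nonneg_left hjensen mgf_nonneg).trans hmgf
    _ = _ := by
        rw [← Real.exp_add]
        congr 1
        rw [hs]
        field_simp
        norm_num

theorem theorem7p2 {Ω : Type*} [MeasurableSpace Ω] (μ : MeasureTheory.Measure Ω)
    [MeasureTheory.IsProbabilityMeasure μ] (m n : ℕ)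
    (A : Matrix (Fin m) (Fin n) ℝ) (X : Ω → Matrix (Fin m) (Fin n) ℝ)
    (hX : ∀ j k, Measurable (fun ω => X ω j k))
    (hindep : ProbabilityTheory.iIndepFun
      (fun (p : Fin m × Fin n) (ω : Ω) => X ω p.1 p.2) μ)
    (hmean : ∀ j k, ∫ ω, X ω j k ∂μ = A j k)
    (D : ℝ) (hD : 0 < D)
    (hbound : ∀ j k, ∀ᵐ ω ∂μ, |X ω j k| ≤ D / 2) :
    MeasureTheory.Integrable (fun ω => ‖A - X ω‖) μ ∧
      ∀ t : ℝ, 0 < t →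
        μ.real {ω | ‖A - X ω‖ > (∫ ω', ‖A - X ω'‖ ∂μ) + t} ≤
          Real.exp (-t ^ 2 / (4 * D ^ 2)) := by
  let e := Fintype.equivFin (Fin m × Fin n)
  let M : (Fin (Fintype.card (Fin m × Fin n)) → ℝ) →ₗ[ℝ] Matrix (Fin m) (Fin n) ℝ :=
    { toFun := fun x => Matrix.of fun j k => x (e (j, k))
      map_add' := fun _ _ => rfl
      map_smul' := fun _ _ => rfl }
  have hM_apply : ∀ x j k, M x j k = x (e (j, k)) := fun _ _ _ => rfl
  have hM : ∀ ω, M (fun i => X ω (e.symm i).1 (e.symm i).2) = X ω := fun ω => by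
    ext j k; simp [hM_apply]
  have hconv : ConvexOn ℝ univ fun x => ‖A - M x‖ := by
    refine ⟨convex_univ, fun x _ y _ a b ha hb hab => ?_⟩
    have h : A - M (a • x + b • y) = a • (A - M x) + b • (A - M y) := by
      rw [map_add, map_smul, map_smul, smul_sub, smul_sub, sub_add_sub_comm, ← add_smul, hab,
        one_smul]
    simp only [h]
    refine (norm_add_le _ _).trans_eq ?_
    rw [norm_smul, norm_smul, Real.norm_of_nonneg ha, Real.norm_of_nonneg hb, smul_eq_mul,
      smul_eq_mul]
  have hlip : ∀ x y, ‖A - M x‖ - ‖A - M y‖ ≤ √(∑ i, (x i - y i) ^ 2) := fun x y => by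
    calc _ ≤ ‖M (y - x)‖ := (norm_sub_norm_le _ _).trans_eq (by rw [map_sub]; congr 1; abel)
      _ ≤ √(∑ p : Fin m × Fin n, M (y - x) p.1 p.2 ^ 2) := Matrix.l2_opNorm_le_sqrt_sum_sq _
      _ = _ := by
          congr 1
          refine Fintype.sum_equiv e _ _ fun p => ?_
          simp only [hM_apply, Pi.sub_apply]
          ring
  simpa only [hM] using concentration_convex_lipschitz
    (Y := fun i ω => X ω (e.symm i).1 (e.symm i).2) (fun i => hX _ _)
    (hindep.precomp e.symm.injective) hD (fun i => hbound _ _) hconv (fun _ => norm_nonneg _) hlip
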